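/- For a nonnegative integer $n$ let $[n]=\{1,\dots,n\}$. A graph $G=(V,E)$ with $V=[n]$ is called a \emph{permutation graph} if there is a permutation $\pi$ of $[n]$ such that, for all $1\le i<j\le n$, $\{i,j\}\in E$ if and only if $\pi(i)>\pi(j)$. An independent set of $G$ is \emph{maximum} if no independent set of $G$ has larger cardinality. Given a graph $G$ and two independent sets $I,J$ of $G$, \textsc{Independent Set Reconfiguration} asks whether there are $\ell\ge 0$ and independent sets $I_0,I_1,\dots,I_\ell$ of $G$ such that $I_0=I$, $I_\ell=J$ and, for every $1\le i\le \ell$, $I_i\setminus I_{i-1}=\{v\}$ and $I_{i-1}\setminus I_i=\{u\}$ for some vertices $u,v$. \textsc{Token Sliding} is the same question with the additional requirement that, in every step, $u$ and $v$ are adjacent in $G$. \textbf{Statement.} Both \textsc{Independent Set Reconfiguration} and \textsc{Token Sliding} can be solved in polynomial time on inputs $(G,I,J)$ in which $G$ is a permutation graph and $I$ and $J$ are maximum independent sets of $G$. That is, for each of the two problems there are a Turing machine and a polynomial $p$ such that, on every such input, given as the string consisting of the rows of the adjacency matrix of $G$ followed by the characteristic vectors of $I$ and $J$ (each row and vector terminated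 by a separator), the machine halts after at most $p(N)$ steps with the correct yes/no answer, where $N$ is the length of the input string. (The permutation $\pi$ is not part of the input.) -/

import Mathlib

namespace TokenReconfiguration

/-- A graph on the linearly ordered vertex set `{0, …, n - 1}` is a permutation graph if there is a
permutation `π` whose inversions are exactly the edges. -/
def IsPermutationGraph {n : ℕ} (G : SimpleGraph (Fin n)) : Prop :=
  ∃ π : Equiv.Perm (Fin n), ∀ i j : Fin n, i < j → (π j < π i ↔ G.Adj i j)

/-- An input of the reconfiguration problems: a finite graph with two sets of vertices. -/
structure Input where
  n : ℕ
  G : SimpleGraph (Fin n)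
  I : Finset (Fin n)
  J : Finset (Fin n)

/-- `S 0, …, S ℓ` are independent sets, each of them obtained from the preceding one by exchanging
one vertex `u` for another vertex `v` such that `step u v` holds. -/
def IsReconfSequence {V : Type*} [DecidableEq V] (G : SimpleGraph V) (step : V → V → Prop)
    (ℓ : ℕ) (S : ℕ → Finset V) : Prop :=
  (∀ i ≤ ℓ, G.IsIndepSet (S i : Set V)) ∧
    ∀ i < ℓ, ∃ u v : V, S (i + 1) \ S i = {v} ∧ S i \ S (i + 1) = {u} ∧ step u v

/-- The question of Independent Set Reconfiguration. -/
def IndependentSetReconfiguration (x : Input) : Prop :=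
  ∃ (ℓ : ℕ) (S : ℕ → Finset (Fin x.n)),
    IsReconfSequence x.G (fun _ _ => True) ℓ S ∧ S 0 = x.I ∧ S ℓ = x.J

/-- The question of Token Sliding: the exchanged vertices have to be adjacent. -/
def TokenSliding (x : Input) : Prop :=
  ∃ (ℓ : ℕ) (S : ℕ → Finset (Fin x.n)),
    IsReconfSequence x.G x.G.Adj ℓ S ∧ S 0 = x.I ∧ S ℓ = x.J

/-- The promise: the graph is a permutation graph and both sets are maximum independent sets. -/
def IsMaximumPermutationInput (x : Input) : Prop :=
  IsPermutationGraph x.G ∧ x.G.IsMaximumIndepSet x.I ∧ x.G.IsMaximumIndepSet x.J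

open Classical in
/-- The characteristic vector of a subset of `{0, …, n - 1}` as `n` bits, closed by a comma. -/
noncomputable def encodeRow {n : ℕ} (p : Fin n → Prop) : List Computability.Γ' :=
  (List.ofFn fun i => Computability.Γ'.bit (decide (p i))) ++ [Computability.Γ'.comma]

/-- An input as a string: the rows of the adjacency matrix, followed by the characteristic vectors
of the two vertex sets. The string has length `(n + 2) * (n + 1)`. -/
noncomputable def encodeInput (x : Input) : List Computability.Γ' :=
  (List.ofFn fun i : Fin x.n => encodeRow fun j => x.G.Adj i j).flatten ++
    encodeRow (fun i => i ∈ x.I) ++ encodeRow (fun i => i ∈ x.J)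

open Classical in
/-- The decision problem `P` on the inputs `x` with `promise x` is solved by a (multi-stack) Turing
machine which, on every such input, halts with the bit `P x` as its output after at most `p(N)`
steps, where `p` is a polynomial and `N` is the length of the string that encodes `x`. -/
def SolvableInPolyTime {α : Type} (enc : α → List Computability.Γ')
    (promise P : α → Prop) : Prop :=
  Nonempty (Turing.TM2ComputableInPolyTime
    (fun x : {x : α // promise x} => enc x.1) Computability.encodeBool
    (fun x => decide (P x.1)))

end TokenReconfiguration

namespace TokenReconfiguration

/-! When a maximum independent set `S` exchanges `u` for `v`, maximality gives `v` a neighbour in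
`S`, and only `u` can be one. So every exchange slides a token along an edge, and both problems have
the same answer on maximum sets.

Orient each slide towards the larger vertex (`Shift`). In a permutation graph both adjacency and
non-adjacency are transitive along the vertex order, which makes two shifts out of one set confluent
(`IsOrderTransitive.shift_diamond`). Each shift lowers `rank`, which is at most `n * n`. Hence every
maximum set has a unique normal form, and two sets are reconfigurable iff their normal forms agree
(`IsOrderTransitive.reconfigurable_iff`).

A greedy pass offers each vertex the chance to receive a token from a smaller one. It lowers `rank`
unless the set is already normal, so `n * n` passes suffice (`iterate_greedyPass_spec`). No
permutation `π` is needed.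

The machine does no arithmetic: it runs one pass per input symbol, which is enough because the
matrix has more than `n * n` symbols unless `n = 0`. Stacks reverse the input, so position `p`
always stands for the vertex `Fin.rev p`. While a row is scanned, its own vertex is recognised as
the first unmarked cell. Both token sets are processed together and compared at the end. -/

/-- The two transitivity properties of a permutation graph with respect to the vertex order. -/
structure IsOrderTransitive {V : Type*} [LinearOrder V] (G : SimpleGraph V) : Prop where
  adj_trans : ∀ {i j k : V}, i < j → j < k → G.Adj i j → G.Adj j k → G.Adj i k
  not_adj_trans : ∀ {i j k : V}, i < j → j < k → ¬ G.Adj i j → ¬ G.Adj j k → ¬ G.Adj i k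

lemma IsPermutationGraph.isOrderTransitive {n : ℕ} {G : SimpleGraph (Fin n)}
    (h : IsPermutationGraph G) : IsOrderTransitive G := by
  obtain ⟨π, hπ⟩ := h
  constructor
  · intro i j k hij hjk h₁ h₂
    rw [← hπ _ _ (hij.trans hjk)]
    exact ((hπ _ _ hjk).2 h₂).trans ((hπ _ _ hij).2 h₁)
  · intro i j k hij hjk h₁ h₂
    rw [← hπ _ _ hij, not_lt] at h₁
    rw [← hπ _ _ hjk, not_lt] at h₂
    rw [← hπ _ _ (hij.trans hjk), not_lt]
    exact h₁.trans h₂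

/-! ### Confluence of upward token shifts -/

section Shift

set_option linter.unusedSectionVars false

variable {V : Type*} [LinearOrder V] [Finite V] {G : SimpleGraph V} {S T I J : Finset V}

/-- `T` arises from the maximum independent set `S` by moving one token to a larger vertex. -/
def Shift (G : SimpleGraph V) (S T : Finset V) : Prop :=
  G.IsMaximumIndepSet S ∧ ∃ u v : V, u < v ∧ u ∈ S ∧ G.Adj u v ∧
    (∀ w ∈ S, G.Adj w v → w = u) ∧ T = insert v (S.erase u)

lemma isIndepSet_insert_erase {u v : V} (hS : G.IsIndepSet (S : Set V))
    (h : ∀ w ∈ S, G.Adj w v → w = u) :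
    G.IsIndepSet (insert v (S.erase u) : Finset V) := by
  intro a ha b hb hab
  simp only [Finset.coe_insert, Finset.coe_erase, Set.mem_insert_iff, Set.mem_sdiff,
    Finset.mem_coe, Set.mem_singleton_iff] at ha hb
  rcases ha with rfl | ⟨ha, hau⟩ <;> rcases hb with rfl | ⟨hb, hbu⟩
  · exact absurd rfl hab
  · exact fun e => hbu (h b hb e.symm)
  · exact fun e => hau (h a ha e)
  · exact hS ha hb hab

lemma not_mem_of_adj {u v : V} (hS : G.IsIndepSet (S : Set V)) (hu : u ∈ S) (h : G.Adj u v) :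
    v ∉ S := fun hv => hS hu hv h.ne h

lemma Shift.isMaximum (h : Shift G S T) : G.IsMaximumIndepSet T := by
  obtain ⟨hS, u, v, -, hu, huv, huniq, rfl⟩ := h
  refine ⟨isIndepSet_insert_erase hS.1 huniq, fun t ht => (hS.2 t ht).trans ?_⟩
  rw [Finset.card_insert_of_notMem
    fun hv => not_mem_of_adj hS.1 hu huv (Finset.mem_of_mem_erase hv),
    Finset.card_erase_add_one hu]

lemma isMaximum_of_reflTransGen (hS : G.IsMaximumIndepSet S)
    (h : Relation.ReflTransGen (Shift G) S T) : G.IsMaximumIndepSet T := by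
  induction h with
  | refl => exact hS
  | tail _ h _ => exact h.isMaximum

lemma exists_adj_of_isMaximum {v : V} (hS : G.IsMaximumIndepSet S) (hv : v ∉ S) :
    ∃ u ∈ S, G.Adj u v := by
  by_contra! h
  have hind : G.IsIndepSet (insert v S : Finset V) := by
    intro a ha b hb hab
    simp only [Finset.coe_insert, Set.mem_insert_iff, Finset.mem_coe] at ha hb
    rcases ha with rfl | ha <;> rcases hb with rfl | hb
    · exact absurd rfl hab
    · exact fun e => h b hb e.symm
    · exact h a ha
    · exact hS.1 ha hb hab
  have := hS.2 _ hind
  rw [Finset.card_insert_of_notMem hv] at this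
  omega

/-- Two targets of the same token are automatically adjacent: once the token is on `v`, maximality
gives `v'` a neighbour in the new set, and only `v` is available. So the shorter move can be
continued to the longer one. -/
lemma shift_of_lt {u v v' : V} (hS : G.IsMaximumIndepSet S) (hu : u ∈ S) (hlt : u < v)
    (hv : G.Adj u v) (hv' : G.Adj u v')
    (huniq : ∀ w ∈ S, G.Adj w v → w = u) (huniq' : ∀ w ∈ S, G.Adj w v' → w = u) (hvv : v < v') :
    Shift G (insert v (S.erase u)) (insert v' (S.erase u)) := by
  have hmax : G.IsMaximumIndepSet (insert v (S.erase u)) :=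
    Shift.isMaximum ⟨hS, u, v, hlt, hu, hv, huniq, rfl⟩
  have hvS : v ∉ S := not_mem_of_adj hS.1 hu hv
  have hv'S : v' ∉ S := not_mem_of_adj hS.1 hu hv'
  have hw : ∀ w ∈ insert v (S.erase u), G.Adj w v' → w = v := by
    intro w hw hadj
    rcases Finset.mem_insert.1 hw with rfl | hw
    · rfl
    · exact absurd (huniq' w (Finset.mem_of_mem_erase hw) hadj) (Finset.ne_of_mem_erase hw)
  refine ⟨hmax, v, v', hvv, Finset.mem_insert_self _ _, ?_, hw, ?_⟩
  · obtain ⟨w, hwm, hadj⟩ := exists_adj_of_isMaximum (v := v') hmax (by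
      simp [hv'S, hvv.ne'])
    rwa [hw w hwm hadj] at hadj
  · rw [Finset.erase_insert fun h => hvS (Finset.mem_of_mem_erase h)]

/-- The position of `u'` relative to `v` decides. If `v < u'`, an edge `v v'` would compose with `u
v` to the forbidden edge `u v'`; if `u' < v`, the non-edges `u u'` and `u' v` would compose to a
non-edge `u v`. -/
lemma IsOrderTransitive.not_adj_of_shift (hG : IsOrderTransitive G) {u v u' v' : V}
    (hlt : u < v) (hlt' : u' < v') (hadj : G.Adj u v)
    (huu : ¬ G.Adj u u') (huv' : ¬ G.Adj u v') (hu'v : ¬ G.Adj u' v)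
    (h : u < u') : ¬ G.Adj v v' := by
  intro hvv
  rcases lt_trichotomy v u' with hv | rfl | hv
  · exact huv' (hG.adj_trans hlt (hv.trans hlt') hadj hvv)
  · exact huu hadj
  · exact hG.not_adj_trans h hv huu hu'v hadj

lemma insert_erase_insert_erase {u v u' v' : V} (hvu' : v ≠ u')
    (hv'u : v' ≠ u) :
    insert v' ((insert v (S.erase u)).erase u') = insert v ((insert v' (S.erase u')).erase u) := by
  ext x
  simp only [Finset.mem_insert, Finset.mem_erase]
  by_cases h1 : x = v'
  · subst h1; simp [hv'u]
  · by_cases h2 : x = v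
    · subst h2; simp [hvu']
    · simp [h1, h2]; tauto

/-- The diamond property of token shifts. -/
lemma IsOrderTransitive.shift_diamond (hG : IsOrderTransitive G) (S T T' : Finset V)
    (h : Shift G S T) (h' : Shift G S T') :
    ∃ D, Relation.ReflGen (Shift G) T D ∧ Relation.ReflTransGen (Shift G) T' D := by
  have hT := h.isMaximum
  have hT' := h'.isMaximum
  obtain ⟨hS, u, v, hlt, hu, hadj, huniq, rfl⟩ := h
  obtain ⟨-, u', v', hlt', hu', hadj', huniq', rfl⟩ := h'
  by_cases huu : u = u'
  · subst huu
    rcases lt_trichotomy v v' with hv | rfl | hv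
    · exact ⟨_, .single (shift_of_lt hS hu hlt hadj hadj' huniq huniq' hv), .refl⟩
    · exact ⟨_, .refl, .refl⟩
    · exact ⟨_, .refl, .single (shift_of_lt hS hu hlt' hadj' hadj huniq' huniq hv)⟩
  -- Different tokens: the two shifts commute, provided that the targets `v` and `v'` do not
  -- conflict.
  have hnuu : ¬ G.Adj u u' := hS.1 hu hu' huu
  have huv' : ¬ G.Adj u v' := fun e => huu (huniq' u hu e)
  have hu'v : ¬ G.Adj u' v := fun e => huu (huniq u' hu' e).symm
  have hvv : ¬ G.Adj v v' := by
    rcases lt_or_gt_of_ne huu with h | h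
    · exact hG.not_adj_of_shift hlt hlt' hadj hnuu huv' hu'v h
    · exact fun e => hG.not_adj_of_shift hlt' hlt hadj' (fun e => hnuu e.symm) hu'v huv' h e.symm
  have hvu' : v ≠ u' := by rintro rfl; exact hnuu hadj
  have hv'u : v' ≠ u := by rintro rfl; exact hnuu hadj'.symm
  refine ⟨insert v' ((insert v (S.erase u)).erase u'), .single ⟨hT, u', v', hlt', ?_, hadj', ?_, rfl⟩,
    .single ⟨hT', u, v, hlt, ?_, hadj, ?_, insert_erase_insert_erase hvu' hv'u⟩⟩
  · simp [hu', Ne.symm huu]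
  · intro w hw e
    rcases Finset.mem_insert.1 hw with rfl | hw
    · exact absurd e hvv
    · exact huniq' w (Finset.mem_of_mem_erase hw) e
  · simp [hu, huu]
  · intro w hw e
    rcases Finset.mem_insert.1 hw with rfl | hw
    · exact absurd e.symm hvv
    · exact huniq w (Finset.mem_of_mem_erase hw) e

lemma eq_insert_erase_of_sdiff {u v : V} (h₁ : T \ S = {v}) (h₂ : S \ T = {u}) :
    T = insert v (S.erase u) := by
  ext x
  have e₁ := Finset.ext_iff.1 h₁ x
  have e₂ := Finset.ext_iff.1 h₂ x
  simp only [Finset.mem_sdiff, Finset.mem_singleton, Finset.mem_insert, Finset.mem_erase] at *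
  tauto

/-- Maximality supplies the edge: `v` needs a neighbour in `S`, and any neighbour other than `u`
would remain in `T` beside `v`. -/
lemma shift_of_sdiff {u v : V} (hS : G.IsMaximumIndepSet S) (hT : G.IsIndepSet (T : Set V))
    (h₁ : T \ S = {v}) (h₂ : S \ T = {u}) (hlt : u < v) : Shift G S T := by
  have hv : v ∈ T \ S := h₁ ▸ Finset.mem_singleton_self v
  have hu : u ∈ S \ T := h₂ ▸ Finset.mem_singleton_self u
  rw [Finset.mem_sdiff] at hu hv
  have huniq : ∀ w ∈ S, G.Adj w v → w = u := by
    intro w hw hadj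
    by_contra hne
    have hwT : w ∈ T := by
      by_contra hwT
      exact hne (Finset.mem_singleton.1 (h₂ ▸ Finset.mem_sdiff.2 ⟨hw, hwT⟩))
    exact hT hwT hv.1 hadj.ne hadj
  obtain ⟨w, hw, hadj⟩ := exists_adj_of_isMaximum hS hv.2
  have := huniq w hw hadj
  subst this
  exact ⟨hS, w, v, hlt, hw, hadj, huniq, eq_insert_erase_of_sdiff h₁ h₂⟩

lemma isMaximum_of_sdiff {u v : V} (hS : G.IsMaximumIndepSet S) (hT : G.IsIndepSet (T : Set V))
    (h₁ : T \ S = {v}) (h₂ : S \ T = {u}) : G.IsMaximumIndepSet T := by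
  refine ⟨hT, fun t ht => (hS.2 t ht).trans ?_⟩
  have a := Finset.card_sdiff_add_card_inter S T
  have b := Finset.card_sdiff_add_card_inter T S
  rw [h₁, Finset.card_singleton] at b
  rw [h₂, Finset.card_singleton] at a
  rw [Finset.inter_comm] at b
  omega

lemma shift_or_shift_of_sdiff {u v : V} (hS : G.IsMaximumIndepSet S)
    (hT : G.IsIndepSet (T : Set V)) (h₁ : T \ S = {v}) (h₂ : S \ T = {u}) :
    Shift G S T ∨ Shift G T S := by
  have hv : v ∈ T \ S := h₁ ▸ Finset.mem_singleton_self v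
  have hu : u ∈ S \ T := h₂ ▸ Finset.mem_singleton_self u
  rw [Finset.mem_sdiff] at hu hv
  rcases lt_trichotomy u v with h | rfl | h
  · exact .inl (shift_of_sdiff hS hT h₁ h₂ h)
  · exact absurd hv.1 hu.2
  · exact .inr (shift_of_sdiff (isMaximum_of_sdiff hS hT h₁ h₂) hS.1 h₂ h₁ h)

lemma Shift.exists_sdiff (h : Shift G S T) :
    ∃ u v, T \ S = {v} ∧ S \ T = {u} ∧ G.Adj u v := by
  obtain ⟨hS, u, v, hlt, hu, hadj, -, rfl⟩ := h
  have hvS : v ∉ S := not_mem_of_adj hS.1 hu hadj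
  refine ⟨u, v, ?_, ?_, hadj⟩ <;> ext x <;>
    simp only [Finset.mem_sdiff, Finset.mem_singleton, Finset.mem_insert, Finset.mem_erase]
  · constructor
    · tauto
    · rintro rfl; tauto
  · constructor
    · tauto
    · rintro rfl; exact ⟨hu, by simp [hlt.ne]⟩

lemma IsOrderTransitive.join_of_isReconfSequence (hG : IsOrderTransitive G)
    {step : V → V → Prop} {S : ℕ → Finset V} (hS : G.IsMaximumIndepSet (S 0)) :
    ∀ {ℓ : ℕ}, IsReconfSequence G step ℓ S →
      G.IsMaximumIndepSet (S ℓ) ∧ Relation.Join (Relation.ReflTransGen (Shift G)) (S 0) (S ℓ)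
  | 0, _ => ⟨hS, _, .refl, .refl⟩
  | ℓ + 1, h => by
    obtain ⟨hmax, hjoin⟩ := join_of_isReconfSequence hG hS (ℓ := ℓ)
      ⟨fun i hi => h.1 i (by omega), fun i hi => h.2 i (by omega)⟩
    obtain ⟨u, v, h₁, h₂, -⟩ := h.2 ℓ (by omega)
    have hind := h.1 (ℓ + 1) le_rfl
    refine ⟨isMaximum_of_sdiff hmax hind h₁ h₂, ?_⟩
    refine (Relation.equivalence_join_reflTransGen hG.shift_diamond).trans hjoin ?_
    rcases shift_or_shift_of_sdiff hmax hind h₁ h₂ with h | h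
    · exact ⟨_, .single h, .refl⟩
    · exact ⟨_, .refl, .single h⟩

/-- There is a reconfiguration sequence from `I` to `J`. -/
def Reconfigurable (G : SimpleGraph V) (step : V → V → Prop) (I J : Finset V) : Prop :=
  ∃ (ℓ : ℕ) (S : ℕ → Finset V), IsReconfSequence G step ℓ S ∧ S 0 = I ∧ S ℓ = J

lemma Reconfigurable.head {step : V → V → Prop} {u v : V} (hI : G.IsIndepSet (I : Set V))
    (h₁ : T \ I = {v}) (h₂ : I \ T = {u}) (huv : step u v) (h : Reconfigurable G step T J) :
    Reconfigurable G step I J := by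
  obtain ⟨ℓ, S, hS, rfl, rfl⟩ := h
  refine ⟨ℓ + 1, fun i => Nat.casesOn i I S, ⟨?_, ?_⟩, rfl, rfl⟩
  · rintro (_ | i) hi
    · exact hI
    · exact hS.1 i (by omega)
  · rintro (_ | i) hi
    · exact ⟨u, v, h₁, h₂, huv⟩
    · exact hS.2 i (by omega)

/-- Shift upwards from `I` to `S`, then undo the shifts from `J`; undoing one is again a slide along
an edge because adjacency is symmetric. -/
lemma Reconfigurable.of_common {step : V → V → Prop} (hstep : ∀ u v, G.Adj u v → step u v)
    (hI : G.IsMaximumIndepSet I) (hIS : Relation.ReflTransGen (Shift G) I S)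
    (hJS : Relation.ReflTransGen (Shift G) J S) :
    Reconfigurable G step I J := by
  induction hIS using Relation.ReflTransGen.head_induction_on with
  | refl =>
    have aux : ∀ {K}, Relation.ReflTransGen (Shift G) J K → G.IsMaximumIndepSet K →
        Reconfigurable G step K J := by
      intro K hJK hK
      induction hJK with
      | refl => exact ⟨0, fun _ => J, ⟨fun _ _ => hK.1, by simp⟩, rfl, rfl⟩
      | tail _ h ih =>
        obtain ⟨u, v, h₁, h₂, huv⟩ := h.exists_sdiff
        exact .head hK.1 h₂ h₁ (hstep _ _ huv.symm) (ih h.1)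
    exact aux hJS hI
  | head h _ ih =>
    obtain ⟨u, v, h₁, h₂, huv⟩ := h.exists_sdiff
    exact .head hI.1 h₁ h₂ (hstep _ _ huv) (ih h.isMaximum)

/-- Reconfigurability is equality of the normal forms with respect to shifts. -/
theorem IsOrderTransitive.reconfigurable_iff (hG : IsOrderTransitive G) {step : V → V → Prop}
    (hstep : ∀ u v, G.Adj u v → step u v) (hI : G.IsMaximumIndepSet I) {I' J' : Finset V}
    (hII : Relation.ReflTransGen (Shift G) I I') (hJJ : Relation.ReflTransGen (Shift G) J J')
    (hI' : ∀ T, ¬ Shift G I' T) (hJ' : ∀ T, ¬ Shift G J' T) :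
    Reconfigurable G step I J ↔ I' = J' := by
  constructor
  · rintro ⟨ℓ, S, hS, rfl, rfl⟩
    have e := Relation.equivalence_join_reflTransGen hG.shift_diamond
    -- By confluence, having a common descendant is an equivalence relation, so `I'` and `J'` have
    -- one; being irreducible, both equal it.
    obtain ⟨K, h₁, h₂⟩ := e.trans (e.symm ⟨I', hII, .refl⟩)
      (e.trans (hG.join_of_isReconfSequence hI hS).2 ⟨J', hJJ, .refl⟩)
    have h₁ : K = I' := (Relation.reflTransGen_iff_eq hI').1 h₁
    have h₂ : K = J' := (Relation.reflTransGen_iff_eq hJ').1 h₂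
    exact h₁.symm.trans h₂
  · rintro rfl
    exact .of_common hstep hI hII hJJ

end Shift

/-! ### Computing normal forms by greedy passes -/

section Greedy

variable {n : ℕ} {G : SimpleGraph (Fin n)} {S T : Finset (Fin n)}

/-- `v` has a unique neighbour in `S`, and this neighbour is smaller than `v`. -/
def HasUniqueSmallerNeighbor (G : SimpleGraph (Fin n)) (S : Finset (Fin n)) (v : Fin n) : Prop :=
  ∃ u, u < v ∧ u ∈ S ∧ G.Adj u v ∧ ∀ w ∈ S, G.Adj w v → w = u

open Classical in
/-- Move a token to `v` if it is a shift. -/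
noncomputable def greedyStep (G : SimpleGraph (Fin n)) (v : Fin n) (S : Finset (Fin n)) :
    Finset (Fin n) :=
  if HasUniqueSmallerNeighbor G S v then insert v (S.filter fun u => ¬ G.Adj u v) else S

lemma shift_greedyStep {v : Fin n} (hS : G.IsMaximumIndepSet S)
    (h : HasUniqueSmallerNeighbor G S v) : Shift G S (greedyStep G v S) := by
  have h' := h
  obtain ⟨u, hlt, hu, hadj, huniq⟩ := h
  refine ⟨hS, u, v, hlt, hu, hadj, huniq, ?_⟩
  rw [greedyStep, if_pos h']
  congr 1
  ext x
  simp only [Finset.mem_filter, Finset.mem_erase]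
  constructor
  · rintro ⟨hx, hxv⟩
    exact ⟨by rintro rfl; exact hxv hadj, hx⟩
  · rintro ⟨hxu, hx⟩
    exact ⟨hx, fun e => hxu (huniq x hx e)⟩

/-- The sum of the distances of the tokens to the end of the vertex order. -/
def rank (S : Finset (Fin n)) : ℕ := ∑ x ∈ S, (n - x)

lemma rank_le (S : Finset (Fin n)) : rank S ≤ n * n := by
  calc rank S ≤ ∑ _x ∈ S, n := Finset.sum_le_sum fun x _ => Nat.sub_le _ _
    _ = S.card * n := by simp
    _ ≤ n * n := Nat.mul_le_mul_right _ (by simpa using S.card_le_univ)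

lemma Shift.rank_lt (h : Shift G S T) : rank T < rank S := by
  obtain ⟨hS, u, v, hlt, hu, hadj, -, rfl⟩ := h
  have hvS : v ∉ S.erase u := fun h => not_mem_of_adj hS.1 hu hadj (Finset.mem_of_mem_erase h)
  rw [rank, rank, Finset.sum_insert hvS, ← Finset.add_sum_erase S _ hu]
  -- With `u < v` this gives `u < n`, so the truncated subtraction in `rank` really drops.
  have := v.2
  have : (u : ℕ) < v := hlt
  omega

/-- Apply the greedy step for each vertex of a list in turn. -/
noncomputable def greedyPass (G : SimpleGraph (Fin n)) (l : List (Fin n)) (S : Finset (Fin n)) :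
    Finset (Fin n) :=
  l.foldl (fun S v => greedyStep G v S) S

/-- The last clause drives termination: if `v` can receive a token at the start, then either some
earlier vertex of the list has caused a shift, or the set is still `S` when `v` is reached. -/
lemma greedyPass_spec (l : List (Fin n)) {S : Finset (Fin n)} (hS : G.IsMaximumIndepSet S) :
    Relation.ReflTransGen (Shift G) S (greedyPass G l S) ∧ rank (greedyPass G l S) ≤ rank S ∧
      ((∃ v ∈ l, HasUniqueSmallerNeighbor G S v) → rank (greedyPass G l S) < rank S) := by
  induction l generalizing S with
  | nil => exact ⟨.refl, le_rfl, by simp⟩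
  | cons v l ih =>
    change _ ∧ rank (greedyPass G l (greedyStep G v S)) ≤ _ ∧
      (_ → rank (greedyPass G l (greedyStep G v S)) < _)
    by_cases h : HasUniqueSmallerNeighbor G S v
    · have hs := shift_greedyStep hS h
      obtain ⟨h₁, h₂, -⟩ := ih hs.isMaximum
      have := hs.rank_lt
      exact ⟨.head hs h₁, by omega, fun _ => by omega⟩
    · have hs : greedyStep G v S = S := if_neg h
      obtain ⟨h₁, h₂, h₃⟩ := ih hS
      rw [hs]
      refine ⟨by simpa [greedyPass, hs] using h₁, h₂, ?_⟩
      rintro ⟨w, hw, hu⟩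
      rcases List.mem_cons.1 hw with rfl | hw
      · exact absurd hu h
      · exact h₃ ⟨w, hw, hu⟩

lemma exists_hasUniqueSmallerNeighbor (h : Shift G S T) :
    ∃ v, HasUniqueSmallerNeighbor G S v := by
  obtain ⟨-, u, v, h₁, h₂, h₃, h₄, -⟩ := h
  exact ⟨v, u, h₁, h₂, h₃, h₄⟩

/-- Sufficiently many greedy passes lead to a normal form with respect to shifts. -/
lemma iterate_greedyPass_spec {l : List (Fin n)} (hl : ∀ v, v ∈ l) (N : ℕ)
    (hS : G.IsMaximumIndepSet S) (hN : rank S ≤ N) :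
    Relation.ReflTransGen (Shift G) S ((greedyPass G l)^[N] S) ∧
      ∀ T, ¬ Shift G ((greedyPass G l)^[N] S) T := by
  induction N generalizing S with
  | zero => exact ⟨.refl, fun T h => by have := h.rank_lt; rw [Function.iterate_zero_apply] at this; omega⟩
  | succ N ih =>
    obtain ⟨h₁, h₂, h₃⟩ := greedyPass_spec l hS
    rw [Function.iterate_succ_apply]
    by_cases h : ∃ T, Shift G S T
    · obtain ⟨T, hT⟩ := h
      obtain ⟨v, hv⟩ := exists_hasUniqueSmallerNeighbor hT
      have := h₃ ⟨v, hl v, hv⟩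
      obtain ⟨h₄, h₅⟩ := ih (isMaximum_of_reflTransGen hS h₁) (by omega)
      exact ⟨h₁.trans h₄, h₅⟩
    · push Not at h
      have e : greedyPass G l S = S := (Relation.reflTransGen_iff_eq h).1 h₁
      have e' : (greedyPass G l)^[N] S = S := Function.iterate_fixed e N
      rw [e, e']
      exact ⟨.refl, h⟩

end Greedy


open Turing Computability TM2.Stmt

/-! ### The machine -/

/-- The stacks of the machine. -/
inductive Stk
  | inp | out | mat | mat' | work | work' | cnt
  deriving DecidableEq

instance : Fintype Stk where
  elems := {.inp, .out, .mat, .mat', .work, .work', .cnt}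
  complete x := by cases x <;> decide

/-- The memory cell of a vertex: its two characteristic bits and whether its row has already been
processed in the current pass. -/
abbrev Cell := Bool × Bool × Bool

/-- A cell during the processing of a row: the adjacency bit, whether the row belongs to
this vertex, and the cell. -/
abbrev ScanCell := Bool × Bool × Cell

/-- The stack alphabets. -/
@[reducible] def Sym : Stk → Type
  | .inp => Γ'
  | .out => Bool
  | .mat => Γ'
  | .mat' => Γ'
  | .work => Cell
  | .work' => ScanCell
  | .cnt => Unit

/-- The result of searching the tokens in the neighbourhood of a vertex `v`: none so far, a single
one that comes after `v`, or anything else. -/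
inductive Count
  | zero | one | bad
  deriving DecidableEq

instance : Fintype Count where
  elems := {.zero, .one, .bad}
  complete x := by cases x <;> decide

/-- Count one more token if `hit`; `seen` tells whether it comes after `v`. -/
def Count.next (seen hit : Bool) (c : Count) : Count :=
  if hit then (if c = .zero ∧ seen then .one else .bad) else c

/-- The state of scanning a row: whether the vertex of the row has been passed, and the results for
the two token sets. -/
abbrev Scan := Bool × Count × Count

/-- The initial state of scanning a row. -/
abbrev Scan.init : Scan := (false, .zero, .zero)

/-- Scanning one cell with adjacency bit `a`. -/
def Scan.next (s : Scan) (a : Bool) (w : Cell) : Scan :=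
  (s.1 || !w.2.2, s.2.1.next s.1 (a && w.1), s.2.2.next s.1 (a && w.2.1))

/-- The cell recorded while scanning. -/
def Scan.record (s : Scan) (a : Bool) (w : Cell) : ScanCell :=
  (a, !s.1 && !w.2.2, w)

/-- The updated characteristic bit of a vertex. -/
def updateBit (c : Count) (a isV b : Bool) : Bool :=
  if c = .one then isV || (b && !a) else b

/-- The updated cell; the marks are reset when the row is the last one. -/
def Scan.update (s : Scan) (last : Bool) (x : ScanCell) : Cell :=
  (updateBit s.2.1 x.1 x.2.1 x.2.2.1, updateBit s.2.2 x.1 x.2.1 x.2.2.2.1,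
    !last && (x.2.2.2.2 || x.2.1))

/-- The internal states of the machine: registers for the symbols read, and the data kept. -/
structure Reg where
  sym : Option Γ' := none
  cell : Option Cell := none
  cell' : Option ScanCell := none
  scan : Scan := .init
  last : Bool := false
  eq : Bool := true

noncomputable instance : Fintype Reg :=
  Fintype.ofInjective (fun s : Reg => (s.sym, s.cell, s.cell', s.scan, s.last, s.eq)) <| by
    rintro ⟨⟩ ⟨⟩ h
    simpa using h

/-- The function labels of the machine. -/
inductive Lbl
  | load | loadJ | loadI | merge | pass | row | fwd | bwd | restore | compare | clear
  deriving DecidableEq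

instance : Fintype Lbl where
  elems := {.load, .loadJ, .loadI, .merge, .pass, .row, .fwd, .bwd, .restore, .compare, .clear}
  complete x := by cases x <;> decide

/-- Whether the symbol read is a bit. -/
def isBit : Option Γ' → Bool
  | some (.bit _) => true
  | _ => false

/-- The value of the symbol read. -/
def bitVal : Option Γ' → Bool
  | some (.bit b) => b
  | _ => false

/-- Discard the symbols read. -/
def Reg.flush (s : Reg) : Reg := { s with sym := none, cell := none, cell' := none }

/-- The program. -/
def program : Lbl → TM2.Stmt Sym Lbl Reg
  | .load =>
    pop .inp (fun s o => { s with sym := o }) <|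
    branch (fun s => s.sym.isNone)
      -- The symbol dropped is the comma closing the vector of `J`, which reversal has put on top.
      (pop .mat (fun s _ => s) <| load Reg.flush <| goto fun _ => .loadJ)
      -- One counter unit per input symbol fixes the number of passes.
      (push .mat (fun s => s.sym.getD .comma) <| push .cnt (fun _ => ()) <|
        load Reg.flush <| goto fun _ => .load)
  | .loadJ =>
    pop .mat (fun s o => { s with sym := o }) <|
    branch (fun s => isBit s.sym)
      (push .work' (fun s => (false, false, false, bitVal s.sym, false)) <|
        load Reg.flush <| goto fun _ => .loadJ)
      (load Reg.flush <| goto fun _ => .loadI)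
  | .loadI =>
    peek .mat (fun s o => { s with sym := o }) <|
    branch (fun s => isBit s.sym)
      (pop .mat (fun s _ => s) <| push .mat' (fun s => s.sym.getD .comma) <|
        load Reg.flush <| goto fun _ => .loadI)
      (load Reg.flush <| goto fun _ => .merge)
  | .merge =>
    pop .work' (fun s o => { s with cell' := o }) <|
    branch (fun s => s.cell'.isNone)
      (load Reg.flush <| goto fun _ => .pass)
      (pop .mat' (fun s o => { s with sym := o }) <|
        push .work (fun s => (bitVal s.sym, (s.cell'.getD default).2.2.2.1, false)) <|
        load Reg.flush <| goto fun _ => .merge)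
  | .pass =>
    pop .cnt (fun s o => { s with sym := o.map fun _ => .comma }) <|
    branch (fun s => s.sym.isNone)
      (load Reg.flush <| goto fun _ => .compare)
      (load Reg.flush <| goto fun _ => .row)
  | .row =>
    pop .mat (fun s o => { s with sym := o }) <|
    branch (fun s => s.sym.isNone)
      (load (fun _ => {}) <| goto fun _ => .restore)
      (push .mat' (fun s => s.sym.getD .comma) <| load (fun _ => {}) <| goto fun _ => .fwd)
  | .fwd =>
    pop .work (fun s o => { s with cell := o }) <|
    branch (fun s => s.cell.isNone)
      -- An empty matrix stack means that this row ends the pass, so the marks have to be reset.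
      (peek .mat (fun s o => { s with last := o.isNone }) <| load Reg.flush <|
        goto fun _ => .bwd)
      (pop .mat (fun s o => { s with sym := o }) <|
        push .mat' (fun s => s.sym.getD .comma) <|
        push .work' (fun s => s.scan.record (bitVal s.sym) (s.cell.getD default)) <|
        load (fun s =>
          { s.flush with scan := s.scan.next (bitVal s.sym) (s.cell.getD default) }) <|
        goto fun _ => .fwd)
  | .bwd =>
    pop .work' (fun s o => { s with cell' := o }) <|
    branch (fun s => s.cell'.isNone)
      (load (fun _ => {}) <| goto fun _ => .row)
      (push .work (fun s => s.scan.update s.last (s.cell'.getD default)) <|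
        load Reg.flush <| goto fun _ => .bwd)
  | .restore =>
    pop .mat' (fun s o => { s with sym := o }) <|
    branch (fun s => s.sym.isNone)
      (load Reg.flush <| goto fun _ => .pass)
      (push .mat (fun s => s.sym.getD .comma) <| load Reg.flush <| goto fun _ => .restore)
  | .compare =>
    pop .work (fun s o => { s with cell := o }) <|
    branch (fun s => s.cell.isNone)
      (load Reg.flush <| goto fun _ => .clear)
      (load (fun s =>
          { s.flush with
            eq := s.eq && ((s.cell.getD default).1 == (s.cell.getD default).2.1) }) <|
        goto fun _ => .compare)
  | .clear =>
    pop .mat (fun s o => { s with sym := o }) <|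
    branch (fun s => s.sym.isNone)
      (push .out (fun s => s.eq) <| load (fun _ => {}) <| halt)
      (load Reg.flush <| goto fun _ => .clear)

/-- The machine that decides both reconfiguration problems. -/
noncomputable def machine : FinTM2 where
  K := Stk
  k₀ := .inp
  k₁ := .out
  Γ := Sym
  Λ := Lbl
  main := .load
  σ := Reg
  initialState := {}
  Γk₀Fin := inferInstanceAs (Fintype Γ')
  m := program

/-- A configuration of the stacks. -/
def mkStacks (inp : List Γ') (out : List Bool) (mat mat' : List Γ') (work : List Cell)
    (work' : List ScanCell) (cnt : List Unit) : ∀ k, List (Sym k)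
  | .inp => inp
  | .out => out
  | .mat => mat
  | .mat' => mat'
  | .work => work
  | .work' => work'
  | .cnt => cnt

section update

variable (a : List Γ') (b : List Bool) (c d : List Γ') (e : List Cell) (f : List ScanCell)
  (g : List Unit)

@[simp] lemma update_stacks_inp (x : List Γ') :
    Function.update (mkStacks a b c d e f g) .inp x = mkStacks x b c d e f g := by
  funext k; cases k <;> rfl

@[simp] lemma update_stacks_out (x : List Bool) :
    Function.update (mkStacks a b c d e f g) .out x = mkStacks a x c d e f g := by
  funext k; cases k <;> rfl

@[simp] lemma update_stacks_mat (x : List Γ') :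
    Function.update (mkStacks a b c d e f g) .mat x = mkStacks a b x d e f g := by
  funext k; cases k <;> rfl

@[simp] lemma update_stacks_mat' (x : List Γ') :
    Function.update (mkStacks a b c d e f g) .mat' x = mkStacks a b c x e f g := by
  funext k; cases k <;> rfl

@[simp] lemma update_stacks_work (x : List Cell) :
    Function.update (mkStacks a b c d e f g) .work x = mkStacks a b c d x f g := by
  funext k; cases k <;> rfl

@[simp] lemma update_stacks_work' (x : List ScanCell) :
    Function.update (mkStacks a b c d e f g) .work' x = mkStacks a b c d e x g := by
  funext k; cases k <;> rfl

@[simp] lemma update_stacks_cnt (x : List Unit) :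
    Function.update (mkStacks a b c d e f g) .cnt x = mkStacks a b c d e f x := by
  funext k; cases k <;> rfl

@[simp] lemma stacks_inp : mkStacks a b c d e f g .inp = a := rfl
@[simp] lemma stacks_out : mkStacks a b c d e f g .out = b := rfl
@[simp] lemma stacks_mat : mkStacks a b c d e f g .mat = c := rfl
@[simp] lemma stacks_mat' : mkStacks a b c d e f g .mat' = d := rfl
@[simp] lemma stacks_work : mkStacks a b c d e f g .work = e := rfl
@[simp] lemma stacks_work' : mkStacks a b c d e f g .work' = f := rfl
@[simp] lemma stacks_cnt : mkStacks a b c d e f g .cnt = g := rfl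

end update

/-- The configurations of the machine. -/
abbrev Config := TM2.Cfg Sym Lbl Reg

/-- The machine passes from one configuration to another in `k` steps. -/
inductive Steps : ℕ → Config → Config → Prop
  | refl (c : Config) : Steps 0 c c
  | head {k : ℕ} {c c₁ c₂ : Config} (h : TM2.step program c = some c₁) (h' : Steps k c₁ c₂) :
    Steps (k + 1) c c₂

lemma Steps.single {c c' : Config} (h : TM2.step program c = some c') : Steps 1 c c' :=
  .head h (.refl _)

lemma Steps.trans {k l : ℕ} {c₁ c₂ c₃ : Config} (h : Steps k c₁ c₂) (h' : Steps l c₂ c₃) :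
    Steps (k + l) c₁ c₃ := by
  induction h with
  | refl => simpa using h'
  | head h _ ih => rw [Nat.add_right_comm]; exact .head h (ih h')

lemma Steps.of_eq {k l : ℕ} {c c' : Config} (h : Steps k c c') (e : k = l) : Steps l c c' := e ▸ h

lemma Steps.iterate {k : ℕ} {c c' : Config} (h : Steps k c c') :
    (flip bind (TM2.step program))^[k] (some c) = some c' := by
  induction h with
  | refl => rfl
  | head h _ ih => rw [Function.iterate_succ_apply]; change _^[_] (TM2.step program _) = _; rw [h, ih]

/-! ### Effect and running time of the loops of the program -/

variable {inp : List Γ'} {mat mat' : List Γ'} {work : List Cell} {work' : List ScanCell}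
  {cnt : List Unit}

lemma steps_load (l : List Γ') :
    Steps (l.length + 1) ⟨some .load, {}, mkStacks l [] mat [] [] [] cnt⟩
      ⟨some .loadJ, {}, mkStacks [] [] (l.reverse ++ mat).tail [] [] []
        (List.replicate l.length () ++ cnt)⟩ := by
  induction l generalizing mat cnt with
  | nil => exact .single (by simp [program, Reg.flush])
  | cons x l ih =>
    refine .head (c₁ := ⟨some .load, {}, mkStacks l [] (x :: mat) [] [] [] (() :: cnt)⟩)
      (by simp [program, Reg.flush]) ?_
    have := ih (mat := x :: mat) (cnt := () :: cnt)
    simpa [List.replicate_succ'] using this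

lemma steps_loadJ (l : List Bool) :
    Steps (l.length + 1)
      ⟨some .loadJ, {}, mkStacks [] [] (l.map .bit ++ .comma :: mat) [] [] work' cnt⟩
      ⟨some .loadI, {}, mkStacks [] [] mat [] []
        ((l.map fun b => (false, false, false, b, false)).reverse ++ work') cnt⟩ := by
  induction l generalizing work' with
  | nil => exact .single (by simp [program, Reg.flush, isBit])
  | cons x l ih =>
    refine .head (by simp [program, Reg.flush, isBit, bitVal]; rfl) ?_
    have := ih (work' := (false, false, false, x, false) :: work')
    simpa using this

/-- The terminating symbol is only peeked at, since after reversal this comma opens the top matrix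
row. `hmat` also allows an empty matrix. -/
lemma steps_loadI (l : List Bool) (hmat : isBit mat.head? = false) :
    Steps (l.length + 1)
      ⟨some .loadI, {}, mkStacks [] [] (l.map .bit ++ mat) mat' [] work' cnt⟩
      ⟨some .merge, {}, mkStacks [] [] mat ((l.map .bit).reverse ++ mat') [] work' cnt⟩ := by
  induction l generalizing mat' with
  | nil => exact .single (by simp [program, Reg.flush, hmat])
  | cons x l ih =>
    refine .head (by simp [program, Reg.flush, isBit]; rfl) ?_
    have := ih (mat' := .bit x :: mat')
    simpa using this

lemma steps_merge (l : List (Bool × Bool)) :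
    Steps (l.length + 1)
      ⟨some .merge, {}, mkStacks [] [] mat (l.map fun x => .bit x.1) work
        (l.map fun x => (false, false, false, x.2, false)) cnt⟩
      ⟨some .pass, {}, mkStacks [] [] mat []
        ((l.map fun x => (x.1, x.2, false)).reverse ++ work) [] cnt⟩ := by
  induction l generalizing work with
  | nil => exact .single (by simp [program, Reg.flush])
  | cons x l ih =>
    refine .head (by simp [program, Reg.flush, bitVal]; rfl) ?_
    have := ih (work := (x.1, x.2, false) :: work)
    simpa using this

/-- One step of scanning a row. -/
def scanStep (x : Scan × List ScanCell) (y : Bool × Cell) : Scan × List ScanCell :=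
  (x.1.next y.1 y.2, x.1.record y.1 y.2 :: x.2)

lemma steps_fwd (l : List (Bool × Cell)) (s : Scan) :
    Steps (l.length + 1)
      ⟨some .fwd, { scan := s },
        mkStacks [] [] (l.map (fun y => .bit y.1) ++ mat) mat' (l.map Prod.snd) work' cnt⟩
      ⟨some .bwd, { scan := (l.foldl scanStep (s, work')).1, last := mat.isEmpty },
        mkStacks [] [] mat ((l.map fun y => .bit y.1).reverse ++ mat') []
          (l.foldl scanStep (s, work')).2 cnt⟩ := by
  induction l generalizing s mat' work' with
  | nil => exact .single (by cases mat <;> simp [program, Reg.flush])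
  | cons x l ih =>
    refine .head (by simp [program, Reg.flush, bitVal]; rfl) ?_
    have := ih (s.next x.1 x.2) (mat' := .bit x.1 :: mat') (work' := s.record x.1 x.2 :: work')
    simpa [scanStep] using this

lemma steps_bwd (l : List ScanCell) (s : Scan) (last : Bool) :
    Steps (l.length + 1)
      ⟨some .bwd, { scan := s, last := last }, mkStacks [] [] mat mat' work l cnt⟩
      ⟨some .row, {}, mkStacks [] [] mat mat' ((l.map (s.update last)).reverse ++ work) [] cnt⟩ := by
  induction l generalizing work with
  | nil => exact .single (by simp [program])
  | cons x l ih =>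
    refine .head (by simp [program, Reg.flush]; rfl) ?_
    have := ih (work := s.update last x :: work)
    simpa using this

/-- The effect of processing a row. -/
def rowUpdate (last : Bool) (r : List Bool) (w : List Cell) : List Cell :=
  let x := (r.zip w).foldl scanStep (.init, [])
  (x.2.map (x.1.update last)).reverse

lemma length_foldl_scanStep (l : List (Bool × Cell)) (x : Scan × List ScanCell) :
    (l.foldl scanStep x).2.length = l.length + x.2.length := by
  induction l generalizing x with
  | nil => simp
  | cons y l ih => rw [List.foldl_cons, ih]; simp [scanStep]; omega

lemma length_rowUpdate {last : Bool} {r : List Bool} {w : List Cell} (h : r.length = w.length) :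
    (rowUpdate last r w).length = w.length := by
  simp [rowUpdate, length_foldl_scanStep, h]

/-- A row on the matrix stack. -/
def encRow (r : List Bool) : List Γ' := .comma :: r.map .bit

lemma steps_row (r : List Bool) (h : r.length = work.length) :
    Steps (2 * work.length + 3)
      ⟨some .row, {}, mkStacks [] [] (encRow r ++ mat) mat' work [] cnt⟩
      ⟨some .row, {}, mkStacks [] [] mat ((encRow r).reverse ++ mat')
        (rowUpdate mat.isEmpty r work) [] cnt⟩ := by
  have h₀ : Steps 1 ⟨some .row, {}, mkStacks [] [] (encRow r ++ mat) mat' work [] cnt⟩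
      ⟨some .fwd, { scan := .init },
        mkStacks [] [] (r.map .bit ++ mat) (.comma :: mat') work [] cnt⟩ :=
    .single (by simp [program, encRow])
  have h₁ := steps_fwd (mat := mat) (mat' := .comma :: mat') (work' := []) (cnt := cnt)
    (r.zip work) .init
  have h₂ := steps_bwd (mat := mat) (mat' := ((r.zip work).map fun y => Γ'.bit y.1).reverse ++
    .comma :: mat') (work := []) (cnt := cnt) ((r.zip work).foldl scanStep (.init, [])).2
    ((r.zip work).foldl scanStep (.init, [])).1 mat.isEmpty
  have e₁ : (r.zip work).map (fun y => Γ'.bit y.1) = r.map .bit := by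
    conv_rhs => rw [← List.map_fst_zip h.le, List.map_map]
    rfl
  have e₂ : (r.zip work).map Prod.snd = work := List.map_snd_zip h.ge
  rw [e₁, e₂] at h₁
  rw [e₁] at h₂
  have h₃ := (h₀.trans h₁).trans h₂
  have := h₃.of_eq (l := 2 * work.length + 3) (by simp [length_foldl_scanStep, h]; omega)
  simpa [rowUpdate, encRow] using this

/-- The effect of processing several rows. -/
def rowsUpdate : List (List Bool) → List Cell → List Cell
  | [], w => w
  | r :: rs, w => rowsUpdate rs (rowUpdate rs.isEmpty r w)

lemma length_rowsUpdate {rs : List (List Bool)} {w : List Cell}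
    (h : ∀ r ∈ rs, r.length = w.length) : (rowsUpdate rs w).length = w.length := by
  induction rs generalizing w with
  | nil => rfl
  | cons r rs ih =>
    have e := length_rowUpdate (last := rs.isEmpty) (h r List.mem_cons_self)
    rw [rowsUpdate, ih fun r' hr' => (h r' (List.mem_cons_of_mem _ hr')).trans e.symm, e]

lemma isEmpty_flatMap_encRow (rs : List (List Bool)) :
    (rs.flatMap encRow).isEmpty = rs.isEmpty := by
  cases rs <;> simp [encRow]

lemma steps_rows (rs : List (List Bool)) (h : ∀ r ∈ rs, r.length = work.length) :
    Steps (rs.length * (2 * work.length + 3))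
      ⟨some .row, {}, mkStacks [] [] (rs.flatMap encRow) mat' work [] cnt⟩
      ⟨some .row, {}, mkStacks [] [] [] ((rs.flatMap encRow).reverse ++ mat')
        (rowsUpdate rs work) [] cnt⟩ := by
  induction rs generalizing work mat' with
  | nil => simpa [rowsUpdate] using Steps.refl _
  | cons r rs ih =>
    have hr := h r List.mem_cons_self
    have e := length_rowUpdate (last := rs.isEmpty) hr
    have h₁ := steps_row (mat := rs.flatMap encRow) (mat' := mat') (cnt := cnt) r hr
    rw [isEmpty_flatMap_encRow] at h₁
    have h₂ := ih (work := rowUpdate rs.isEmpty r work) (mat' := (encRow r).reverse ++ mat')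
      fun r' hr' => (h r' (List.mem_cons_of_mem _ hr')).trans e.symm
    rw [e] at h₂
    have := (h₁.trans h₂).of_eq (l := (r :: rs).length * (2 * work.length + 3))
      (by rw [List.length_cons]; ring)
    simpa [rowsUpdate] using this

lemma steps_restore (l : List Γ') :
    Steps (l.length + 1) ⟨some .restore, {}, mkStacks [] [] mat l work [] cnt⟩
      ⟨some .pass, {}, mkStacks [] [] (l.reverse ++ mat) [] work [] cnt⟩ := by
  induction l generalizing mat with
  | nil => exact .single (by simp [program, Reg.flush])
  | cons x l ih =>
    refine .head (by simp [program, Reg.flush]; rfl) ?_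
    simpa using ih (mat := x :: mat)

lemma length_flatMap_encRow {rs : List (List Bool)} {k : ℕ} (h : ∀ r ∈ rs, r.length = k) :
    (rs.flatMap encRow).length = rs.length * (k + 1) := by
  induction rs with
  | nil => simp
  | cons r rs ih =>
    rw [List.flatMap_cons, List.length_append, ih fun r' hr' => h r' (List.mem_cons_of_mem _ hr')]
    simp [encRow, h r List.mem_cons_self]
    ring

lemma steps_pass (rs : List (List Bool)) (h : ∀ r ∈ rs, r.length = work.length) :
    Steps (rs.length * (3 * work.length + 4) + 3)
      ⟨some .pass, {}, mkStacks [] [] (rs.flatMap encRow) [] work [] (() :: cnt)⟩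
      ⟨some .pass, {}, mkStacks [] [] (rs.flatMap encRow) [] (rowsUpdate rs work) [] cnt⟩ := by
  have h₁ : Steps 1
      ⟨some .pass, {}, mkStacks [] [] (rs.flatMap encRow) [] work [] (() :: cnt)⟩
      ⟨some .row, {}, mkStacks [] [] (rs.flatMap encRow) [] work [] cnt⟩ :=
    .single (by simp [program, Reg.flush])
  have h₂ := steps_rows (mat' := []) (cnt := cnt) rs h
  rw [List.append_nil] at h₂
  have h₃ : Steps 1
      ⟨some .row, {}, mkStacks [] [] [] (rs.flatMap encRow).reverse (rowsUpdate rs work) [] cnt⟩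
      ⟨some .restore, {},
        mkStacks [] [] [] (rs.flatMap encRow).reverse (rowsUpdate rs work) [] cnt⟩ :=
    .single (by simp [program])
  have h₄ := steps_restore (mat := []) (work := rowsUpdate rs work) (cnt := cnt)
    (rs.flatMap encRow).reverse
  rw [List.reverse_reverse, List.append_nil] at h₄
  refine (((h₁.trans h₂).trans h₃).trans h₄).of_eq ?_
  rw [List.length_reverse, length_flatMap_encRow h]
  ring

lemma steps_passes (rs : List (List Bool)) (N : ℕ) (h : ∀ r ∈ rs, r.length = work.length) :
    Steps (N * (rs.length * (3 * work.length + 4) + 3) + 1)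
      ⟨some .pass, {}, mkStacks [] [] (rs.flatMap encRow) [] work [] (List.replicate N ())⟩
      ⟨some .compare, {}, mkStacks [] [] (rs.flatMap encRow) [] ((rowsUpdate rs)^[N] work) [] []⟩ := by
  induction N generalizing work with
  | zero => simpa using .single (by simp [program, Reg.flush])
  | succ N ih =>
    have e := length_rowsUpdate h
    have h₂ := ih (work := rowsUpdate rs work) fun r hr => (h r hr).trans e.symm
    rw [e] at h₂
    exact ((steps_pass rs h).trans h₂).of_eq (by ring)

lemma length_iterate_rowsUpdate (rs : List (List Bool)) (N : ℕ) {w : List Cell}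
    (h : ∀ r ∈ rs, r.length = w.length) : ((rowsUpdate rs)^[N] w).length = w.length := by
  induction N generalizing w with
  | zero => rfl
  | succ N ih =>
    have e := length_rowsUpdate h
    rw [Function.iterate_succ_apply, ih fun r hr => (h r hr).trans e.symm, e]

lemma steps_compare (l : List Cell) (b : Bool) :
    Steps (l.length + 1) ⟨some .compare, { eq := b }, mkStacks [] [] mat [] l [] []⟩
      ⟨some .clear, { eq := b && l.all fun w => w.1 == w.2.1 }, mkStacks [] [] mat [] [] [] []⟩ := by
  induction l generalizing b with
  | nil => exact .single (by simp [program, Reg.flush])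
  | cons x l ih =>
    refine .head (by simp [program, Reg.flush]; rfl) ?_
    simpa [Bool.and_assoc] using ih (b && x.1 == x.2.1)

lemma steps_clear (l : List Γ') (b : Bool) :
    Steps (l.length + 1) ⟨some .clear, { eq := b }, mkStacks [] [] l [] [] [] []⟩
      ⟨none, {}, mkStacks [] [b] [] [] [] [] []⟩ := by
  induction l with
  | nil => exact .single (by simp [program])
  | cons x l ih => exact .head (by simp [program, Reg.flush]) ih

/-- The cells after loading the two characteristic vectors. -/
def initialCells (x : List (Bool × Bool)) : List Cell := x.map fun y => (y.1, y.2, false)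

/-- The run of the machine on an input that consists of rows `rs` and two characteristic vectors,
which are zipped into `x`. -/
theorem steps_machine (rs : List (List Bool)) (x : List (Bool × Bool))
    (h : ∀ r ∈ rs, r.length = x.length) (hx : rs.length = x.length) (input : List Γ')
    (hinput : input.reverse = encRow (x.map Prod.snd) ++ encRow (x.map Prod.fst) ++
      rs.flatMap encRow) :
    ∃ k ≤ 3 * input.length * input.length + 9 * input.length + 10,
      Steps k ⟨some .load, {}, mkStacks input [] [] [] [] [] []⟩
        ⟨none, {}, mkStacks []
          [((rowsUpdate rs)^[input.length] (initialCells x)).all fun w => w.1 == w.2.1]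
          [] [] [] [] []⟩ := by
  have hlen : input.length = (x.length + 2) * (x.length + 1) := by
    rw [← List.length_reverse, hinput, List.length_append, length_flatMap_encRow h, hx]
    simp [encRow]
    ring
  have h₁ := steps_load (mat := []) (cnt := []) input
  rw [hinput] at h₁
  have h₂ := steps_loadJ (mat := x.map (fun y => .bit y.1) ++ rs.flatMap encRow) (work' := [])
    (cnt := List.replicate input.length ()) (x.map Prod.snd)
  have h₃ := steps_loadI (mat := rs.flatMap encRow) (mat' := [])
    (work' := (x.map fun y => (false, false, false, y.2, false)).reverse)
    (cnt := List.replicate input.length ()) (x.map Prod.fst)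
    (by cases rs <;> simp [encRow, isBit])
  -- Loading has reversed both vectors; merging `x.reverse` restores the order of `x`.
  have h₄ := steps_merge (mat := rs.flatMap encRow) (work := [])
    (cnt := List.replicate input.length ()) x.reverse
  have h₅ := steps_passes (work := initialCells x) rs input.length (by simpa [initialCells] using h)
  have h₆ := steps_compare (mat := rs.flatMap encRow)
    ((rowsUpdate rs)^[input.length] (initialCells x)) true
  have h₇ := steps_clear (rs.flatMap encRow)
    (((rowsUpdate rs)^[input.length] (initialCells x)).all fun w => w.1 == w.2.1)
  rw [length_iterate_rowsUpdate _ _ (by simpa [initialCells] using h)] at h₆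
  simp only [encRow, List.map_map, List.cons_append, List.append_nil, List.tail_cons,
    List.append_assoc, List.map_reverse, List.reverse_reverse, Bool.true_and,
    List.length_map, List.length_reverse, Function.comp_def] at h₁ h₂ h₃ h₄ h₅ h₆ h₇
  refine ⟨_, ?_, (((((h₁.trans h₂).trans h₃).trans h₄).trans h₅).trans h₆).trans h₇⟩
  rw [length_flatMap_encRow h, hx, hlen]
  simp only [initialCells, List.length_map]
  generalize x.length = m
  -- One pass costs at most three times the input length; the number of passes is the input length.
  have : m * (3 * m + 4) + 3 ≤ 3 * ((m + 2) * (m + 1)) := by nlinarith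
  have := Nat.mul_le_mul_left ((m + 2) * (m + 1)) this
  nlinarith


/-! ### What the machine computes -/

/-- The result of counting the hits among the first `k` positions. -/
def countUpTo (v : ℕ) (hit : ℕ → Bool) : ℕ → Count
  | 0 => .zero
  | k + 1 => (countUpTo v hit k).next (decide (v < k)) (hit k)

lemma countUpTo_eq_zero_iff (v : ℕ) (hit : ℕ → Bool) (k : ℕ) :
    countUpTo v hit k = .zero ↔ ∀ p < k, hit p = false := by
  induction k with
  | zero => simp [countUpTo]
  | succ k ih =>
    rw [countUpTo, Count.next, Nat.forall_lt_succ_right]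
    cases h : hit k
    · simp [ih]
    · split_ifs <;> simp_all

/-- A second hit, or a first hit not beyond `v`, leads to `.bad`, which is never left. -/
lemma countUpTo_eq_one_iff (v : ℕ) (hit : ℕ → Bool) (k : ℕ) :
    countUpTo v hit k = .one ↔
      ∃ u < k, v < u ∧ hit u = true ∧ ∀ p < k, hit p = true → p = u := by
  induction k with
  | zero => simp [countUpTo]
  | succ k ih =>
    rw [countUpTo, Count.next]
    cases h : hit k
    · rw [if_neg (by simp), ih]
      constructor
      · rintro ⟨u, h₁, h₂, h₃, h₄⟩
        refine ⟨u, by omega, h₂, h₃, fun p hp hh => ?_⟩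
        rcases Nat.lt_succ_iff_lt_or_eq.1 hp with hp | rfl
        · exact h₄ p hp hh
        · simp [h] at hh
      · rintro ⟨u, h₁, h₂, h₃, h₄⟩
        refine ⟨u, ?_, h₂, h₃, fun p hp hh => h₄ p (by omega) hh⟩
        rcases Nat.lt_succ_iff_lt_or_eq.1 h₁ with hu | rfl
        · exact hu
        · simp [h] at h₃
    · rw [if_pos rfl]
      simp only [countUpTo_eq_zero_iff]
      constructor
      · intro e
        split_ifs at e with hc
        refine ⟨k, by omega, by simpa using hc.2, h, fun p hp hh => ?_⟩
        by_contra hne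
        have := hc.1 p (by omega)
        simp [this] at hh
      · rintro ⟨u, h₁, h₂, h₃, h₄⟩
        obtain rfl : k = u := h₄ k (by omega) h
        rw [if_pos]
        refine ⟨fun p hp => ?_, by simpa using h₂⟩
        by_contra hne
        have := h₄ p (by omega) (by simpa using hne)
        omega

/-- The cells of `n` positions of which the first `v` are marked. -/
def cells (n v : ℕ) (i j : ℕ → Bool) : List Cell :=
  (List.range n).map fun p => (i p, j p, decide (p < v))

/-- As exactly the cells before `v` are marked, the first unmarked cell is `v`, and the flag carried
along says whether `v` has been passed. -/
lemma foldl_scanStep_range (v : ℕ) (a i j : ℕ → Bool) (k : ℕ) :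
    ((List.range k).map fun p => (a p, i p, j p, decide (p < v))).foldl scanStep (.init, []) =
      ((decide (v < k), countUpTo v (fun p => a p && i p) k, countUpTo v (fun p => a p && j p) k),
        ((List.range k).map fun p =>
          (a p, decide (p = v), i p, j p, decide (p < v))).reverse) := by
  induction k with
  | zero => rfl
  | succ k ih =>
    rw [List.range_succ, List.map_append, List.foldl_append, ih]
    simp only [List.map_cons, List.map_nil, List.foldl_cons, List.foldl_nil, scanStep, Scan.next,
      Scan.record, List.map_append, List.reverse_append, List.reverse_cons, List.reverse_nil,
      List.nil_append, List.cons_append, countUpTo, Prod.mk.injEq, List.cons.injEq, and_true,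
      true_and]
    constructor <;> rw [Bool.eq_iff_iff] <;> simp <;> omega

lemma rowUpdate_cells (last : Bool) (n v : ℕ) (a i j : ℕ → Bool) :
    rowUpdate last ((List.range n).map a) (cells n v i j) =
      cells n (if last then 0 else v + 1)
        (fun p => updateBit (countUpTo v (fun p => a p && i p) n) (a p) (decide (p = v)) (i p))
        (fun p => updateBit (countUpTo v (fun p => a p && j p) n) (a p) (decide (p = v)) (j p)) := by
  rw [rowUpdate, cells, List.zip_map', foldl_scanStep_range]
  simp only [List.map_reverse, List.reverse_reverse, List.map_map, cells]
  refine List.map_congr_left fun p _ => ?_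
  simp only [Function.comp_apply, Scan.update, Prod.mk.injEq, true_and]
  cases last <;> simp [Nat.le_iff_lt_or_eq]

/-! ### Stack contents as vertex sets -/

section Graph

variable {n : ℕ} (G : SimpleGraph (Fin n))

open Classical in
/-- The characteristic function of a predicate on vertices, listed from the last vertex to the
first one. -/
noncomputable def revChar (q : Fin n → Prop) (p : ℕ) : Bool :=
  decide (∃ h : p < n, q (Fin.rev ⟨p, h⟩))

lemma revChar_apply (q : Fin n → Prop) (p : Fin n) : revChar q p = true ↔ q p.rev := by
  simp [revChar]

lemma revChar_rev (q : Fin n → Prop) (p : Fin n) : revChar q p.rev = true ↔ q p := by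
  rw [revChar_apply, Fin.rev_rev]

lemma revChar_of_le (q : Fin n → Prop) {p : ℕ} (h : n ≤ p) : revChar q p = false := by
  simp [revChar, h]

/-- The row of a vertex. -/
noncomputable def revRow (v : Fin n) : ℕ → Bool := revChar (G.Adj v.rev)

/-- The characteristic function of a vertex set. -/
noncomputable def revSet (S : Finset (Fin n)) : ℕ → Bool := revChar fun u => u ∈ S

/-- Positions run through the vertices backwards, so a hit beyond position `v` is a neighbour
smaller than the vertex `v.rev`. -/
lemma countUpTo_revSet (v : Fin n) (S : Finset (Fin n)) :
    countUpTo v (fun p => revRow G v p && revSet S p) n = .one ↔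
      HasUniqueSmallerNeighbor G S v.rev := by
  have key : ∀ u : Fin n, (revRow G v u.rev && revSet S u.rev) = true ↔ u ∈ S ∧ G.Adj u v.rev := by
    intro u
    rw [Bool.and_eq_true, revRow, revSet, revChar_rev, revChar_rev, and_comm, G.adj_comm]
  rw [countUpTo_eq_one_iff]
  constructor
  · rintro ⟨u, hu, hvu, hhit, huniq⟩
    obtain ⟨u, rfl⟩ : ∃ w : Fin n, u = w.rev := ⟨Fin.rev ⟨u, hu⟩, by rw [Fin.rev_rev]⟩
    obtain ⟨huS, hadj⟩ := (key u).1 hhit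
    refine ⟨u, Fin.lt_rev_iff.2 hvu, huS, hadj, fun w hw hwv => ?_⟩
    exact Fin.rev_injective (Fin.ext (huniq w.rev w.rev.2 ((key w).2 ⟨hw, hwv⟩)))
  · rintro ⟨u, hlt, huS, hadj, huniq⟩
    refine ⟨u.rev, u.rev.2, Fin.lt_rev_iff.1 hlt, (key u).2 ⟨huS, hadj⟩, fun p hp hhit => ?_⟩
    obtain ⟨w, rfl⟩ : ∃ w : Fin n, p = w.rev := ⟨Fin.rev ⟨p, hp⟩, by rw [Fin.rev_rev]⟩
    obtain ⟨hw, hwv⟩ := (key w).1 hhit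
    rw [huniq w hw hwv]

lemma updateBit_revSet (v : Fin n) (S : Finset (Fin n)) :
    (fun p => updateBit (countUpTo v (fun p => revRow G v p && revSet S p) n) (revRow G v p)
      (decide (p = v)) (revSet S p)) = revSet (greedyStep G v.rev S) := by
  funext p
  rw [updateBit, greedyStep]
  by_cases h : HasUniqueSmallerNeighbor G S v.rev
  · rw [if_pos ((countUpTo_revSet G v S).2 h), if_pos h]
    by_cases hp : p < n
    · lift p to Fin n using hp
      rw [Bool.eq_iff_iff]
      simp only [Bool.or_eq_true, Bool.and_eq_true, Bool.not_eq_true', ← Bool.not_eq_true,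
        revRow, revSet, revChar_apply, decide_eq_true_eq, Finset.mem_insert, Finset.mem_filter,
        Fin.rev_inj, Fin.val_inj, G.adj_comm]
    · rw [revSet, revSet, revChar_of_le _ (not_lt.1 hp), revChar_of_le _ (not_lt.1 hp)]
      have := v.2
      simp; omega
  · rw [if_neg (mt (countUpTo_revSet G v S).1 h), if_neg h]

/-- The rows of the given vertices. -/
noncomputable def revRows (l : List (Fin n)) : List (List Bool) :=
  l.map fun v => (List.range n).map (revRow G v)

/-- The induction needs consecutive rows starting at an arbitrary `v`, the current number of marks;
the last row resets the marks to `0`, ready for the next pass. -/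
lemma rowsUpdate_revRows (l : List (Fin n)) (v d : ℕ) (hl : l.map Fin.val = List.range' v d)
    (S T : Finset (Fin n)) :
    rowsUpdate (revRows G l) (cells n v (revSet S) (revSet T)) =
      cells n (if l = [] then v else 0) (revSet (greedyPass G (l.map Fin.rev) S))
        (revSet (greedyPass G (l.map Fin.rev) T)) := by
  induction l generalizing v d S T with
  | nil => rfl
  | cons x l ih =>
    cases d with
    | zero => simp at hl
    | succ d =>
      rw [List.map_cons, List.range'_succ, List.cons.injEq] at hl
      obtain ⟨rfl, hl⟩ := hl
      rw [revRows, List.map_cons, rowsUpdate, rowUpdate_cells, updateBit_revSet, updateBit_revSet]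
      change rowsUpdate (revRows G l) _ = _
      have hempty : (l.map fun v => (List.range n).map (revRow G v)).isEmpty = l.isEmpty := by
        cases l <;> rfl
      rw [hempty]
      cases l with
      | nil => rfl
      | cons y l =>
        have := ih (x + 1) d hl (greedyStep G x.rev S) (greedyStep G x.rev T)
        simpa [greedyPass] using this

/-- All vertices in the order in which the machine treats them. -/
def revVertices (n : ℕ) : List (Fin n) := (List.finRange n).map Fin.rev

lemma iterate_rowsUpdate (N : ℕ) (S T : Finset (Fin n)) :
    (rowsUpdate (revRows G (List.finRange n)))^[N] (cells n 0 (revSet S) (revSet T)) =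
      cells n 0 (revSet ((greedyPass G (revVertices n))^[N] S))
        (revSet ((greedyPass G (revVertices n))^[N] T)) := by
  induction N generalizing S T with
  | zero => rfl
  | succ N ih =>
    rw [Function.iterate_succ_apply, rowsUpdate_revRows G _ 0 n, ite_self, Function.iterate_succ_apply,
      Function.iterate_succ_apply, ← ih]
    · rfl
    · rw [List.map_coe_finRange_eq_range, List.range_eq_range']

lemma all_cells_iff (S T : Finset (Fin n)) :
    ((cells n 0 (revSet S) (revSet T)).all fun w => w.1 == w.2.1) = true ↔ S = T := by
  simp only [cells, List.all_map, List.all_eq_true, List.mem_range, Function.comp_apply, beq_iff_eq]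
  constructor
  · intro h
    ext u
    have := h u.rev u.rev.2
    rw [Bool.eq_iff_iff, revSet, revSet, revChar_rev, revChar_rev] at this
    exact this
  · rintro rfl _ _
    rfl

end Graph

/-! ### Encoding, correctness and the time bound -/

lemma reverse_encodeRow {n : ℕ} (q : Fin n → Prop) :
    (encodeRow q).reverse = encRow ((List.range n).map (revChar q)) := by
  rw [encodeRow, List.reverse_append, encRow, List.reverse_singleton, List.singleton_append,
    List.map_map]
  congr 1
  refine List.ext_getElem (by simp) fun k h₁ h₂ => ?_
  have hk : k < n := by simpa using h₂
  have e : (⟨n - 1 - k, by omega⟩ : Fin n) = Fin.rev ⟨k, hk⟩ := Fin.ext (by simp [Fin.rev]; omega)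
  simp [revChar, hk, e]

/-- The two characteristic vectors of an input, zipped and reversed. -/
noncomputable def revVectors (x : Input) : List (Bool × Bool) :=
  (List.range x.n).map fun p => (revSet x.I p, revSet x.J p)

lemma reverse_encodeInput (x : Input) :
    (encodeInput x).reverse = encRow ((revVectors x).map Prod.snd) ++
      encRow ((revVectors x).map Prod.fst) ++ (revRows x.G (List.finRange x.n)).flatMap encRow := by
  rw [encodeInput, List.reverse_append, List.reverse_append, reverse_encodeRow, reverse_encodeRow,
    List.append_assoc]
  congr 1
  · rw [revVectors, List.map_map]; rfl
  congr 1
  · rw [revVectors, List.map_map]; rfl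
  rw [List.reverse_flatten, List.flatMap_def]
  congr 1
  refine List.ext_getElem (by simp [revRows]) fun k h₁ h₂ => ?_
  have hk : k < x.n := by simpa using h₁
  have e : (⟨x.n - 1 - k, by omega⟩ : Fin x.n) = Fin.rev ⟨k, hk⟩ :=
    Fin.ext (by simp [Fin.rev]; omega)
  simp [revRows, revRow, reverse_encodeRow, e]

/-- Together with `rank_le`, this makes the input length a sufficient number of passes. -/
lemma sq_le_length_encodeInput (x : Input) : x.n * x.n ≤ (encodeInput x).length := by
  have hr : ∀ r ∈ revRows x.G (List.finRange x.n), r.length = x.n := by simp [revRows]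
  rw [← List.length_reverse, reverse_encodeInput, List.length_append, length_flatMap_encRow hr]
  simp [revRows]
  nlinarith

/-- The answer of the machine is correct. -/
theorem all_iterate_iff (x : Input) (hx : IsMaximumPermutationInput x)
    {step : Fin x.n → Fin x.n → Prop} (hstep : ∀ u v, x.G.Adj u v → step u v) :
    (((rowsUpdate (revRows x.G (List.finRange x.n)))^[(encodeInput x).length]
      (initialCells (revVectors x))).all fun w => w.1 == w.2.1) = true ↔
      Reconfigurable x.G step x.I x.J := by
  have e : initialCells (revVectors x) = cells x.n 0 (revSet x.I) (revSet x.J) := by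
    rw [initialCells, revVectors, cells, List.map_map]
    simp [Function.comp_def]
  have hmem : ∀ v, v ∈ revVertices x.n := fun v => by
    simpa [revVertices] using ⟨v.rev, v.rev_rev⟩
  have hN := sq_le_length_encodeInput x
  rw [e, iterate_rowsUpdate, all_cells_iff]
  obtain ⟨hG, hI, hJ⟩ := hx
  obtain ⟨hI₁, hI₂⟩ := iterate_greedyPass_spec hmem (encodeInput x).length hI
    ((rank_le _).trans hN)
  obtain ⟨hJ₁, hJ₂⟩ := iterate_greedyPass_spec hmem (encodeInput x).length hJ
    ((rank_le _).trans hN)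
  exact (hG.isOrderTransitive.reconfigurable_iff hstep hI hI₁ hJ₁ hI₂ hJ₂).symm

lemma initList_machine (l : List Γ') :
    initList machine l = (⟨some .load, {}, mkStacks l [] [] [] [] [] []⟩ : Config) := by
  refine congrArg (TM2.Cfg.mk (some Lbl.load) ({} : Reg)) (funext fun k => ?_)
  cases k <;> rfl

/-- Halting requires initial registers and empty stacks apart from the output; this is why the
program ends by clearing the matrix and resetting its registers. -/
lemma haltList_machine (l : List Bool) :
    haltList machine l = (⟨none, {}, mkStacks [] l [] [] [] [] []⟩ : Config) := by
  refine congrArg (TM2.Cfg.mk none ({} : Reg)) (funext fun k => ?_)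
  cases k <;> rfl

/-- The time bound of the machine. -/
noncomputable def timeBound : Polynomial ℕ := 3 * .X * .X + 9 * .X + 10

/-- The same `machine` serves both problems, since the bit it prints does not involve the step
relation. -/
theorem solvableInPolyTime_of_iff {P : Input → Prop}
    (hP : ∀ x, IsMaximumPermutationInput x → (P x ↔
      (((rowsUpdate (revRows x.G (List.finRange x.n)))^[(encodeInput x).length]
        (initialCells (revVectors x))).all fun w => w.1 == w.2.1) = true)) :
    SolvableInPolyTime encodeInput IsMaximumPermutationInput P := by
  classical
  refine ⟨{
    tm := machine
    inputAlphabet := Equiv.refl _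
    outputAlphabet := Equiv.refl _
    time := timeBound
    outputsFun := fun x => Classical.choice ?_ }⟩
  obtain ⟨x, hx⟩ := x
  obtain ⟨k, hk, hsteps⟩ := steps_machine (revRows x.G (List.finRange x.n)) (revVectors x)
    (by simp [revRows, revVectors]) (by simp [revRows, revVectors]) (encodeInput x)
    (reverse_encodeInput x)
  refine ⟨⟨⟨k, ?_⟩, ?_⟩⟩
  · have h₁ : decide (P x) = ((rowsUpdate (revRows x.G (List.finRange x.n)))^[(encodeInput x).length]
        (initialCells (revVectors x))).all fun w => w.1 == w.2.1 := by
      rw [Bool.eq_iff_iff, decide_eq_true_iff]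
      exact hP x hx
    have h₂ := hsteps.iterate
    -- The input is fed through the alphabet equivalence, here the identity, hence `List.map_id`.
    rw [← h₁, ← initList_machine, ← haltList_machine, ← List.map_id (encodeInput x)] at h₂
    exact h₂
  · simpa [timeBound] using hk

end TokenReconfiguration

theorem mainTheorem3 :
    TokenReconfiguration.SolvableInPolyTime TokenReconfiguration.encodeInput
        TokenReconfiguration.IsMaximumPermutationInput
        TokenReconfiguration.IndependentSetReconfiguration ∧
      TokenReconfiguration.SolvableInPolyTime TokenReconfiguration.encodeInput
        TokenReconfiguration.IsMaximumPermutationInput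
        TokenReconfiguration.TokenSliding := by
  constructor
  · exact TokenReconfiguration.solvableInPolyTime_of_iff fun x hx =>
      (TokenReconfiguration.all_iterate_iff x hx fun _ _ _ => trivial).symm
  · exact TokenReconfiguration.solvableInPolyTime_of_iff fun x hx =>
      (TokenReconfiguration.all_iterate_iff x hx fun _ _ h => h).symm
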